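/- Let $r\ge 1$ and let $S=\{0,1\}^r$ be the set of paths, with dead path $\mathbf 1=(1,\dots,1)$ and mappings $\tau_i\colon S\to S$, $\tau_i(u)=u\vee e_i$ for $i=1,\dots,r$, where $e_i$ is the $i$-th unit vector and $\vee$ is the bitwise OR. An arrangement is a finitely supported function $x\colon(\mathbb N\cup\{0\})\times S\to[0,\infty)$; $x_{n,u}$ is the amount of gold sand in the cell $(n,u)$. The cells $(0,u)$ with $u\ne\mathbf 1$ are called winning cells. In the gold sand game with initial arrangement $x$, at the start and after every round all sand in winning cells becomes Pusher's win and is removed from the field, and all sand on the dead path is removed from the field. In each round Pusher splits the sand of every cell into a standing part and a running part; then Remover, who sees this splitting and the whole field, picks an index $i\in\{1,\dots,r\}$; the standing parts keep their cells and the running part of each cell $(n,u)$ moves to $(n-1,\tau_i(u))$. Pusher's total win is the limit, over infinitely many rounds, of the amount won. For $p$ in the simplex $\Delta=\{p\in\mathbb R^r: p_1,\dots,p_r\ge 0,\ p_1+\dots+p_r=1\}$ define the weights $w(p)$ by $w(p)_{0,u}=1$ for $u\neq\mathbf 1$, $w(p)_{0,\mathbf 1}=0$, and for $n\ge1$ $$w(p)_{n,u}=\sum_{M\in\{0,1\}^r:\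 u\le M,\ M\ne\mathbf 1}(-1)^{r-|M|-1}\,S(M)^n,\qquad S(M)=\sum_{l:\,M_l=1}p_l,$$ where $\le$ is bitwise and $|M|$ is the number of ones of $M$ (so $w(p)_{n,\mathbf 1}=0$). **Proposition (continuous on-line panchromatic coloring).** For every $r\ge1$ and every arrangement $x$, the minimum $\min_{p\in\Delta}x\cdot w(p)$ of $x\cdot w(p)=\sum_{n,u}x_{n,u}w(p)_{n,u}$ is attained, and the gold sand game with initial arrangement $x$ has a value, equal to this minimum: it is the supremum of the total wins that Pusher's strategies can guarantee against every strategy of Remover, and it is also the infimum of the bounds to which Remover's strategies can hold Pusher's total win against every strategy of Pusher. -/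

import Mathlib

open scoped NNReal ENNReal

noncomputable section

/-- The data of a gold sand game: paths `S`, one mapping of the paths for each element of `F`,
and a dead path that is fixed by all the mappings. -/
structure GoldSandGame (S F : Type*) where
  dead : S
  τ : F → S → S
  τ_dead : ∀ i, τ i dead = dead

/-- An arrangement: non-negative amounts of sand in the cells `(n, m)` (level `n`, path `m`),
only finitely many of them nonzero. -/
abbrev Arrangement (S : Type*) : Type _ := (ℕ × S) →₀ ℝ≥0

namespace GoldSandGame

variable {S F : Type*} [Fintype S] [DecidableEq S]

/-- A played round: the field before it, the running part, and the index of Remover's mapping. -/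
structure Round (S F : Type*) where
  field : Arrangement S
  running : Arrangement S
  choice : F

/-- The sand in the winning cells `(0, m)`, `m ≠ dead`. -/
def gain (G : GoldSandGame S F) (x : Arrangement S) : ℝ≥0 :=
  ∑ m ∈ Finset.univ.filter (fun m => m ≠ G.dead), x (0, m)

/-- The field after the removal of the sand on the dead path and of the sand in the winning
cells. -/
def clear (G : GoldSandGame S F) (x : Arrangement S) : Arrangement S :=
  x.filter (fun c => c.2 ≠ G.dead ∧ c.1 ≠ 0)

/-- The running part `y` moves by the rule `(n, m) ↦ (n - 1, τ i m)`. During the game the field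
is always cleared, so no sand of a running part is at level `0`. -/
def shift (G : GoldSandGame S F) (i : F) (y : Arrangement S) : Arrangement S :=
  y.mapDomain (fun c => (c.1 - 1, G.τ i c.2))

/-- Pusher's strategy: given the rounds played so far (the latest one first) and the current
field `x`, it selects the running part, which is any arrangement `y ≤ x`; the standing part
is `x - y`. -/
abbrev PusherStrategy (_G : GoldSandGame S F) : Type _ :=
  List (Round S F) → (x : Arrangement S) → Set.Iic x

/-- Remover's strategy: given the rounds played so far, the current field and the running part
that Pusher has just selected, it selects one of the mappings. -/
abbrev RemoverStrategy (_G : GoldSandGame S F) : Type _ :=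
  List (Round S F) → (x y : Arrangement S) → F

/-- The state of a play: the rounds so far, the current field, and Pusher's win so far. -/
structure State (S F : Type*) where
  history : List (Round S F)
  field : Arrangement S
  won : ℝ≥0

/-- The state before the first round; sand that starts in winning cells is won at once. -/
def start (G : GoldSandGame S F) (x : Arrangement S) : State S F :=
  ⟨[], G.clear x, G.gain x⟩

/-- One round. -/
def step (G : GoldSandGame S F) (σ : G.PusherStrategy) (ρ : G.RemoverStrategy)
    (s : State S F) : State S F :=
  let y : Arrangement S := (σ s.history s.field : Arrangement S)
  let i : F := ρ s.history s.field y
  let z : Arrangement S := (s.field - y) + G.shift i y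
  ⟨⟨s.field, y, i⟩ :: s.history, G.clear z, s.won + G.gain z⟩

/-- The state after `t` rounds. -/
def play (G : GoldSandGame S F) (σ : G.PusherStrategy) (ρ : G.RemoverStrategy)
    (x : Arrangement S) (t : ℕ) : State S F :=
  (G.step σ ρ)^[t] (G.start x)

/-- Pusher's total win in the (infinite) play; the win after `t` rounds is monotone in `t`. -/
def totalWin (G : GoldSandGame S F) (σ : G.PusherStrategy) (ρ : G.RemoverStrategy)
    (x : Arrangement S) : ℝ≥0∞ :=
  ⨆ t : ℕ, ((G.play σ ρ x t).won : ℝ≥0∞)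

/-- The supremum of the wins that Pusher can guarantee. -/
def lowerValue (G : GoldSandGame S F) (x : Arrangement S) : ℝ≥0∞ :=
  ⨆ σ : G.PusherStrategy, ⨅ ρ : G.RemoverStrategy, G.totalWin σ ρ x

/-- The infimum of the bounds to which Remover can hold Pusher's win. -/
def upperValue (G : GoldSandGame S F) (x : Arrangement S) : ℝ≥0∞ :=
  ⨅ ρ : G.RemoverStrategy, ⨆ σ : G.PusherStrategy, G.totalWin σ ρ x

end GoldSandGame

/-- The game of on-line panchromatic `r`-coloring: the paths are `{0,1}^r`, the mapping `τ i` is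
the bitwise OR with the `i`-th unit vector, and the all-ones path is dead. -/
def panchromaticGame (r : ℕ) : GoldSandGame (Fin r → Bool) (Fin r) where
  dead := fun _ => true
  τ := fun i m l => m l || decide (l = i)
  τ_dead := by intro i; funext l; rfl

/-- The weight of the cell `(n, u)`. The sum runs over the `M ≠ (1,…,1)` that are bitwise at
least `u`; these have at most `r - 1` ones, so the exponent of `-1` is not truncated. -/
def panchromaticWeight {r : ℕ} (p : Fin r → ℝ) (n : ℕ) (u : Fin r → Bool) : ℝ :=
  if n = 0 then (if u = (fun _ => true) then 0 else 1)
  else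
    ∑ M ∈ (Finset.univ : Finset (Fin r → Bool)).filter
        (fun M => (∀ l, u l ≤ M l) ∧ M ≠ (fun _ => true)),
      (-1 : ℝ) ^ (r - (Finset.univ.filter (fun l => M l = true)).card - 1) *
        (∑ l ∈ Finset.univ.filter (fun l => M l = true), p l) ^ n

/-- The scalar product `x · w(p)`. -/
def panchromaticDot {r : ℕ} (x : Arrangement (Fin r → Bool)) (p : Fin r → ℝ) : ℝ :=
  x.sum (fun c a => (a : ℝ) * panchromaticWeight p c.1 c.2)

end

/-! `weight` is the chance that a path survives `n` random moves drawn from `p`; the potential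
weighs the sand by it. Remover fixes `p`: averaged over `p`, a move preserves the potential of the
running part, so some index does not increase it (`exists_potential_shift_le`). The win therefore
never exceeds the initial potential. Pusher runs the fraction `ε * n` of the sand at level `n`. As
the mappings commute, the derivative of the weight towards the vertex `i` is `n * (weight (n - 1) (τ
i u) - weight n u)`. So after any reply `i` the potential at `p` is, up to order `ε ^ 2`, at least
that of the old field at `p` tilted towards `i` (`potential_tilt_le`), and a lower bound valid for
all `p` survives the round. The height decays geometrically, so the errors sum to order `ε` and the
potential left on the field vanishes; then `ε → 0` (`le_lowerValue`). Inclusion-exclusion identifies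
the alternating sums with these weights. -/

namespace GoldSandGame

/-! ### Survival probabilities and their expansion under a tilt -/

section Weight

variable {S F : Type*} [DecidableEq S] [Fintype F]

/-- The probability that `n` independent random mappings with distribution `p` do not move the
path `u` to the dead path. -/
def weight (G : GoldSandGame S F) (p : F → ℝ) : ℕ → S → ℝ
  | 0, u => if u = G.dead then 0 else 1
  | n + 1, u => ∑ j, p j * weight G p n (G.τ j u)

theorem weight_nonneg (G : GoldSandGame S F) {p : F → ℝ} (hp : p ∈ stdSimplex ℝ F) (n : ℕ)
    (u : S) : 0 ≤ G.weight p n u := by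
  induction n generalizing u with
  | zero => simp only [weight]; split_ifs <;> norm_num
  | succ n ih => exact Finset.sum_nonneg fun j _ => mul_nonneg (hp.1 j) (ih _)

theorem weight_le_one (G : GoldSandGame S F) {p : F → ℝ} (hp : p ∈ stdSimplex ℝ F) (n : ℕ)
    (u : S) : G.weight p n u ≤ 1 := by
  induction n generalizing u with
  | zero => simp only [weight]; split_ifs <;> norm_num
  | succ n ih =>
    calc ∑ j, p j * G.weight p n (G.τ j u) ≤ ∑ j, p j :=
          Finset.sum_le_sum fun j _ => mul_le_of_le_one_right (hp.1 j) (ih _)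
      _ = 1 := hp.2

theorem weight_dead (G : GoldSandGame S F) (p : F → ℝ) (n : ℕ) : G.weight p n G.dead = 0 := by
  induction n with
  | zero => simp [weight]
  | succ n ih => simp [weight, G.τ_dead, ih]

theorem continuous_weight (G : GoldSandGame S F) (n : ℕ) (u : S) :
    Continuous fun p => G.weight p n u := by
  induction n generalizing u with
  | zero => exact continuous_const
  | succ n ih =>
    exact continuous_finsetSum _ fun j _ => (continuous_apply j).mul (ih _)

variable [DecidableEq F]

/-- The distribution `p` moved towards the vertex `i` by the ratio `ε`. -/
def tilt (p : F → ℝ) (i : F) (ε : ℝ) : F → ℝ := fun j => (1 - ε) * p j + ε * (Pi.single i 1 : F → ℝ) j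

theorem tilt_mem {p : F → ℝ} (hp : p ∈ stdSimplex ℝ F) (i : F) {ε : ℝ} (h0 : 0 ≤ ε)
    (h1 : ε ≤ 1) : tilt p i ε ∈ stdSimplex ℝ F :=
  convex_stdSimplex ℝ F hp (single_mem_stdSimplex ℝ i) (sub_nonneg.2 h1) h0 (sub_add_cancel 1 ε)

theorem weight_tilt_succ (G : GoldSandGame S F) (p : F → ℝ) (i : F) (ε : ℝ) (n : ℕ) (u : S) :
    G.weight (tilt p i ε) (n + 1) u =
      (1 - ε) * ∑ j, p j * G.weight (tilt p i ε) n (G.τ j u) +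
        ε * G.weight (tilt p i ε) n (G.τ i u) := by
  conv_lhs => rw [weight]
  conv_lhs => enter [2, j]; rw [tilt]
  simp only [add_mul, Finset.sum_add_distrib, mul_assoc, ← Finset.mul_sum, Pi.single_apply,
    ite_mul, one_mul, zero_mul, Finset.sum_ite_eq', Finset.mem_univ, if_true]

/-- Each of the `n` draws is altered with probability at most `ε`. This crude bound suffices in the
expansion below, where it is multiplied by a further `ε`. -/
theorem weight_tilt_le (G : GoldSandGame S F) {p : F → ℝ} (hp : p ∈ stdSimplex ℝ F) (i : F)
    {ε : ℝ} (h0 : 0 ≤ ε) (h1 : ε ≤ 1) (n : ℕ) (u : S) :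
    G.weight (tilt p i ε) n u ≤ G.weight p n u + n * ε := by
  induction n generalizing u with
  | zero => simp [weight]
  | succ n ih =>
    rw [weight_tilt_succ]
    have h2 : ∑ j, p j * G.weight (tilt p i ε) n (G.τ j u) ≤ G.weight p (n + 1) u + n * ε := by
      calc _ ≤ ∑ j, p j * (G.weight p n (G.τ j u) + n * ε) :=
            Finset.sum_le_sum fun j _ => mul_le_mul_of_nonneg_left (ih _) (hp.1 j)
        _ = _ := by rw [weight]; simp only [mul_add, Finset.sum_add_distrib, ← Finset.sum_mul, hp.2,
                      one_mul]
    have h3 := G.weight_le_one (tilt_mem hp i h0 h1) n (G.τ i u)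
    have h4 := G.weight_nonneg hp (n + 1) u
    have h5 : (0 : ℝ) ≤ n * ε := by positivity
    have h6 := mul_le_mul_of_nonneg_left h2 (sub_nonneg.2 h1)
    have h7 := mul_le_mul_of_nonneg_left h3 h0
    have h8 := mul_nonneg h0 (add_nonneg h4 h5)
    push_cast
    linarith

/-- A second order expansion of the weight in the direction of a vertex. -/
theorem weight_tilt_le_expansion (G : GoldSandGame S F)
    (hτ : ∀ i j u, G.τ i (G.τ j u) = G.τ j (G.τ i u)) {p : F → ℝ}
    (hp : p ∈ stdSimplex ℝ F) (i : F) {ε : ℝ} (h0 : 0 ≤ ε) (h1 : ε ≤ 1) (n : ℕ) (u : S) :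
    G.weight (tilt p i ε) n u ≤
      (1 - n * ε) * G.weight p n u + n * ε * G.weight p (n - 1) (G.τ i u) + n ^ 2 * ε ^ 2 := by
  induction n generalizing u with
  | zero => simp [weight]
  | succ n ih =>
    -- Commutation lets the move `i` come before the random moves. At `n = 0` the factor `n` cancels
    -- the truncated level `n - 1`.
    have key : ∑ j, p j * (n * ε * G.weight p (n - 1) (G.τ i (G.τ j u))) =
        n * ε * G.weight p n (G.τ i u) := by
      rcases n with _ | n
      · simp
      · conv_rhs => rw [weight]
        rw [Finset.mul_sum]
        refine Finset.sum_congr rfl fun j _ => ?_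
        rw [hτ, Nat.add_sub_cancel]
        ring
    have h2 : ∑ j, p j * G.weight (tilt p i ε) n (G.τ j u) ≤
        (1 - n * ε) * G.weight p (n + 1) u + n * ε * G.weight p n (G.τ i u) + n ^ 2 * ε ^ 2 := by
      calc _ ≤ ∑ j, p j * ((1 - n * ε) * G.weight p n (G.τ j u) +
              n * ε * G.weight p (n - 1) (G.τ i (G.τ j u)) + n ^ 2 * ε ^ 2) :=
            Finset.sum_le_sum fun j _ => mul_le_mul_of_nonneg_left (ih _) (hp.1 j)
        _ = _ := by
            conv_rhs => rw [weight]
            simp only [mul_add, Finset.sum_add_distrib, key, ← Finset.sum_mul, hp.2, one_mul,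
              Finset.mul_sum, mul_left_comm]
    rw [weight_tilt_succ]
    -- The crude bound and the product `(1 - ε) * (1 - n * ε)` each cost at most `n * ε ^ 2`, and `n
    -- ^ 2 + 2 * n ≤ (n + 1) ^ 2`.
    have h3 := G.weight_tilt_le hp i h0 h1 n (G.τ i u)
    have h4 := G.weight_le_one hp (n + 1) u
    have h5 := G.weight_nonneg hp n (G.τ i u)
    have h6 := mul_le_mul_of_nonneg_left h2 (sub_nonneg.2 h1)
    have h7 := mul_le_mul_of_nonneg_left h3 h0
    have hn : (0 : ℝ) ≤ n * ε ^ 2 := by positivity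
    have h8 := mul_le_mul_of_nonneg_left h4 hn
    have h9 := mul_nonneg hn h5
    have h10 : 0 ≤ ε * ((n : ℝ) ^ 2 * ε ^ 2) := by positivity
    have h11 : (0 : ℝ) ≤ ε ^ 2 := by positivity
    rw [Nat.add_sub_cancel]
    push_cast
    nlinarith

end Weight

/-! ### Linear functionals of arrangements and the rules of play -/

section Dot

variable {S F : Type*}

/-- The scalar product of an arrangement with a function on the cells. -/
def dot (x : Arrangement S) (g : ℕ × S → ℝ) : ℝ := x.sum fun c a => (a : ℝ) * g c

theorem dot_add (x y : Arrangement S) (g : ℕ × S → ℝ) : dot (x + y) g = dot x g + dot y g :=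
  Finsupp.sum_add_index' (by simp) (by intros; push_cast; ring)

theorem dot_single (c : ℕ × S) (a : ℝ≥0) (g : ℕ × S → ℝ) :
    dot (Finsupp.single c a) g = a * g c :=
  Finsupp.sum_single_index (by simp)

theorem dot_sub {x y : Arrangement S} (h : y ≤ x) (g : ℕ × S → ℝ) :
    dot (x - y) g = dot x g - dot y g := by
  rw [eq_sub_iff_add_eq, ← dot_add, tsub_add_cancel_of_le h]

theorem dot_le_dot {x : Arrangement S} {g h : ℕ × S → ℝ} (H : ∀ c, x c ≠ 0 → g c ≤ h c) :
    dot x g ≤ dot x h :=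
  Finset.sum_le_sum fun c hc =>
    mul_le_mul_of_nonneg_left (H c (Finsupp.mem_support_iff.1 hc)) (x c).2

theorem dot_congr {x : Arrangement S} {g h : ℕ × S → ℝ} (H : ∀ c, x c ≠ 0 → g c = h c) :
    dot x g = dot x h :=
  le_antisymm (dot_le_dot fun c hc => (H c hc).le) (dot_le_dot fun c hc => (H c hc).ge)

theorem dot_nonneg {x : Arrangement S} {g : ℕ × S → ℝ} (H : ∀ c, x c ≠ 0 → 0 ≤ g c) :
    0 ≤ dot x g :=
  Finset.sum_nonneg fun c hc => mul_nonneg (x c).2 (H c (Finsupp.mem_support_iff.1 hc))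

theorem dot_add_right (x : Arrangement S) (g h : ℕ × S → ℝ) :
    dot x (fun c => g c + h c) = dot x g + dot x h := by
  simp only [dot, mul_add, Finsupp.sum_add]

theorem dot_sum_right [Fintype F] (x : Arrangement S) (g : F → ℕ × S → ℝ) :
    dot x (fun c => ∑ i, g i c) = ∑ i, dot x (g i) := by
  simp only [dot, Finsupp.sum, Finset.mul_sum]
  exact Finset.sum_comm

theorem dot_mul_right (x : Arrangement S) (r : ℝ) (g : ℕ × S → ℝ) :
    dot x (fun c => r * g c) = r * dot x g := by
  simp only [dot, Finsupp.sum, Finset.mul_sum, mul_left_comm]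

/-- The part `min 1 (ε * n)` of the sand at every level `n`. -/
noncomputable def proportional (ε : ℝ≥0) (x : Arrangement S) : Arrangement S :=
  Finsupp.onFinset x.support (fun c => min 1 (ε * c.1) * x c) fun _ hc =>
    Finsupp.mem_support_iff.2 (right_ne_zero_of_mul hc)

theorem proportional_le (ε : ℝ≥0) (x : Arrangement S) : proportional ε x ≤ x := fun _ =>
  mul_le_of_le_one_left bot_le (min_le_left 1 _)

theorem dot_proportional {ε : ℝ≥0} {x : Arrangement S} {N : ℕ}
    (hx : ∀ c, x c ≠ 0 → c.1 ≤ N) (hε : ε * N ≤ 1) (g : ℕ × S → ℝ) :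
    dot (proportional ε x) g = dot x fun c => ε * c.1 * g c := by
  rw [dot, proportional, Finsupp.onFinset_sum _ (by simp)]
  refine Finset.sum_congr rfl fun c hc => ?_
  have h1 : ε * c.1 ≤ 1 := le_trans
    (mul_le_mul_of_nonneg_left (Nat.cast_le.2 (hx c (Finsupp.mem_support_iff.1 hc))) bot_le) hε
  rw [min_eq_right h1]
  push_cast
  ring

/-- The total level of the sand. -/
def height (x : Arrangement S) : ℝ := dot x fun c => c.1

theorem height_nonneg (x : Arrangement S) : 0 ≤ height x :=
  dot_nonneg fun _ _ => Nat.cast_nonneg _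

theorem exists_level_le (x : Arrangement S) : ∃ N : ℕ, 1 ≤ N ∧ ∀ c, x c ≠ 0 → c.1 ≤ N := by
  refine ⟨x.support.sup Prod.fst + 1, by omega, fun c hc => ?_⟩
  exact (Finset.le_sup (f := Prod.fst) (Finsupp.mem_support_iff.2 hc)).trans (Nat.le_succ _)

theorem dot_shift (G : GoldSandGame S F) (i : F) (y : Arrangement S) (g : ℕ × S → ℝ) :
    dot (G.shift i y) g = dot y fun c => g (c.1 - 1, G.τ i c.2) :=
  Finsupp.sum_mapDomain_index (by simp) (by intros; push_cast; ring)

/-- A unit of sand at level `n` loses height `ε * n`, the share that drops one level, whichever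
index is chosen. -/
theorem height_proportional_step (G : GoldSandGame S F) {ε : ℝ≥0} {x : Arrangement S} {N : ℕ}
    (hx0 : ∀ c, x c ≠ 0 → c.1 ≠ 0) (hx : ∀ c, x c ≠ 0 → c.1 ≤ N) (hε : ε * N ≤ 1) (i : F) :
    height ((x - proportional ε x) + G.shift i (proportional ε x)) = (1 - ε) * height x := by
  rw [height, dot_add, dot_sub (proportional_le ε x), dot_shift, dot_proportional hx hε,
    dot_proportional hx hε, height, sub_mul, one_mul, ← dot_mul_right, sub_add, sub_right_inj,
    sub_eq_iff_eq_add, ← dot_add_right]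
  refine dot_congr fun c hc => ?_
  rw [Nat.cast_sub (Nat.one_le_iff_ne_zero.2 (hx0 c hc))]
  push_cast
  ring

variable [DecidableEq S]

/-- Both sides are additive, so single cells suffice. Applied to the weights, it says that clearing
trades potential for win without loss. -/
theorem gain_add_dot_clear [Fintype S] (G : GoldSandGame S F) (x : Arrangement S) {g : ℕ × S → ℝ}
    (h0 : ∀ m, m ≠ G.dead → g (0, m) = 1) (hd : ∀ n, g (n, G.dead) = 0) :
    G.gain x + dot (G.clear x) g = dot x g := by
  induction x using Finsupp.induction_linear with
  | zero =>
    have h : G.clear 0 = 0 := Finsupp.filter_zero _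
    simp [gain, h, dot]
  | add x y hx hy =>
    have h1 : G.gain (x + y) = G.gain x + G.gain y := by
      simp [gain, Finset.sum_add_distrib]
    have h2 : G.clear (x + y) = G.clear x + G.clear y := Finsupp.filter_add
    rw [h1, h2, dot_add, dot_add, ← hx, ← hy]
    push_cast
    ring
  | single c a =>
    obtain ⟨n, m⟩ := c
    rw [dot_single]
    by_cases hm : m = G.dead
    · subst hm
      have h1 : G.gain (Finsupp.single (n, G.dead) a) = 0 := by
        refine Finset.sum_eq_zero fun k hk => ?_
        rw [Finsupp.single_apply, if_neg]
        intro h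
        exact (Finset.mem_filter.1 hk).2 (congrArg Prod.snd h).symm
      have h2 : G.clear (Finsupp.single (n, G.dead) a) = 0 :=
        Finsupp.filter_single_of_neg _ (by simp)
      simp [h1, h2, dot, hd]
    · by_cases hn : n = 0
      · subst hn
        have h1 : G.gain (Finsupp.single (0, m) a) = a := by
          simp only [gain, Finsupp.single_apply, Prod.mk.injEq, true_and]
          rw [Finset.sum_ite_eq, if_pos (by simp [hm])]
        have h2 : G.clear (Finsupp.single (0, m) a) = 0 :=
          Finsupp.filter_single_of_neg _ (by simp)
        simp [h1, h2, dot, h0 m hm]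
      · have h1 : G.gain (Finsupp.single (n, m) a) = 0 := by
          refine Finset.sum_eq_zero fun k _ => ?_
          rw [Finsupp.single_apply, if_neg]
          intro h
          exact hn (congrArg Prod.fst h)
        have h2 : G.clear (Finsupp.single (n, m) a) = Finsupp.single (n, m) a :=
          Finsupp.filter_single_of_pos _ ⟨hm, hn⟩
        simp [h1, h2, dot_single]

theorem clear_apply_ne_zero {G : GoldSandGame S F} {x : Arrangement S} {c : ℕ × S}
    (h : G.clear x c ≠ 0) : c.1 ≠ 0 ∧ x c ≠ 0 := by
  rw [clear, Finsupp.filter_apply] at h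
  split_ifs at h with hc
  · exact ⟨hc.2, h⟩
  · exact absurd rfl h

theorem dot_clear_le (G : GoldSandGame S F) (x : Arrangement S) {g : ℕ × S → ℝ}
    (h : ∀ c, 0 ≤ g c) : dot (G.clear x) g ≤ dot x g := by
  conv_rhs => rw [← Finsupp.filter_add_filter_not x fun c => c.2 ≠ G.dead ∧ c.1 ≠ 0]
  rw [dot_add]
  exact le_add_of_nonneg_right (dot_nonneg fun c _ => h c)

theorem step_level_le (G : GoldSandGame S F) {x y : Arrangement S} (hy : y ≤ x) (i : F) {N : ℕ}
    (hx : ∀ c, x c ≠ 0 → c.1 ≤ N) (c : ℕ × S) (hc : ((x - y) + G.shift i y) c ≠ 0) : c.1 ≤ N := by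
  classical
  rw [Finsupp.add_apply] at hc
  by_cases h : (x - y) c = 0
  · rw [h, zero_add] at hc
    have := Finsupp.mapDomain_support (Finsupp.mem_support_iff.2 hc)
    obtain ⟨d, hd, rfl⟩ := Finset.mem_image.1 this
    have hd' : x d ≠ 0 := fun h0 => Finsupp.mem_support_iff.1 hd
      (le_antisymm (h0 ▸ hy d) bot_le)
    exact (Nat.sub_le _ _).trans (hx d hd')
  · refine hx c fun h0 => h ?_
    rw [Finsupp.tsub_apply, h0, zero_tsub]

theorem play_succ [Fintype S] (G : GoldSandGame S F) (σ : G.PusherStrategy) (ρ : G.RemoverStrategy)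
    (x : Arrangement S) (t : ℕ) : G.play σ ρ x (t + 1) = G.step σ ρ (G.play σ ρ x t) :=
  Function.iterate_succ_apply' _ _ _

theorem play_field_level_ne_zero [Fintype S] (G : GoldSandGame S F) (σ : G.PusherStrategy)
    (ρ : G.RemoverStrategy) (x : Arrangement S) (t : ℕ) (c : ℕ × S)
    (hc : (G.play σ ρ x t).field c ≠ 0) : c.1 ≠ 0 := by
  cases t with
  | zero => exact (clear_apply_ne_zero hc).1
  | succ t => rw [play_succ] at hc; exact (clear_apply_ne_zero hc).1

theorem lowerValue_le_upperValue [Fintype S] (G : GoldSandGame S F) (x : Arrangement S) :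
    G.lowerValue x ≤ G.upperValue x :=
  iSup_iInf_le_iInf_iSup _

end Dot

/-! ### Optimal strategies when the mappings commute -/

section Value

variable {S F : Type*} [DecidableEq S] [Fintype F]

/-- The scalar product of an arrangement with the weights of the cells. -/
def potential (G : GoldSandGame S F) (p : F → ℝ) (x : Arrangement S) : ℝ :=
  dot x fun c => G.weight p c.1 c.2

theorem gain_add_potential_clear [Fintype S] (G : GoldSandGame S F) (p : F → ℝ) (x : Arrangement S) :
    G.gain x + G.potential p (G.clear x) = G.potential p x :=
  G.gain_add_dot_clear x (fun m hm => by simp [weight, hm]) fun n => G.weight_dead p n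

theorem potential_nonneg (G : GoldSandGame S F) {p : F → ℝ} (hp : p ∈ stdSimplex ℝ F)
    (x : Arrangement S) : 0 ≤ G.potential p x :=
  dot_nonneg fun _ _ => G.weight_nonneg hp _ _

theorem continuous_potential (G : GoldSandGame S F) (x : Arrangement S) :
    Continuous fun p => G.potential p x :=
  continuous_finsetSum _ fun c _ => continuous_const.mul (G.continuous_weight c.1 c.2)

/-- This is the recursion of `weight` summed over the cells; it needs levels at least `1`, where `n
- 1` is not truncated. -/
theorem sum_mul_potential_shift (G : GoldSandGame S F) (p : F → ℝ) {y : Arrangement S}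
    (hy : ∀ c, y c ≠ 0 → c.1 ≠ 0) :
    ∑ i, p i * G.potential p (G.shift i y) = G.potential p y := by
  simp only [potential, dot_shift, ← dot_mul_right]
  rw [← dot_sum_right]
  refine dot_congr fun c hc => ?_
  obtain ⟨n, hn⟩ := Nat.exists_eq_succ_of_ne_zero (hy c hc)
  rw [hn]
  rfl

theorem exists_potential_shift_le (G : GoldSandGame S F) {p : F → ℝ}
    (hp : p ∈ stdSimplex ℝ F) {y : Arrangement S} (hy : ∀ c, y c ≠ 0 → c.1 ≠ 0) :
    ∃ i, G.potential p (G.shift i y) ≤ G.potential p y := by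
  by_contra! h
  have h1 : ∑ i, p i * G.potential p y < ∑ i, p i * G.potential p (G.shift i y) := by
    obtain ⟨i, hi⟩ : ∃ i, 0 < p i := by
      by_contra! h0
      have := Finset.sum_nonpos fun i (_ : i ∈ Finset.univ) => h0 i
      rw [hp.2] at this
      linarith
    exact Finset.sum_lt_sum (fun j _ => mul_le_mul_of_nonneg_left (h j).le (hp.1 j))
      ⟨i, Finset.mem_univ _, mul_lt_mul_of_pos_left (h i) hi⟩
  rw [G.sum_mul_potential_shift p hy, ← Finset.sum_mul, hp.2, one_mul] at h1
  exact lt_irrefl _ h1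

/-- Remover's strategy that does not let the potential of the running part increase. -/
noncomputable def greedyRemover (G : GoldSandGame S F) [Nonempty F] (p : F → ℝ) : G.RemoverStrategy :=
  fun _ _ y => Classical.epsilon fun i => G.potential p (G.shift i y) ≤ G.potential p y

theorem won_add_potential_greedyRemover_le [Fintype S] (G : GoldSandGame S F) [Nonempty F] {p : F → ℝ}
    (hp : p ∈ stdSimplex ℝ F) (σ : G.PusherStrategy) (x : Arrangement S) (t : ℕ) :
    (G.play σ (G.greedyRemover p) x t).won +
      G.potential p (G.play σ (G.greedyRemover p) x t).field ≤ G.potential p x := by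
  induction t with
  | zero => exact (G.gain_add_potential_clear p x).le
  | succ t ih =>
    have hf := G.play_field_level_ne_zero σ (G.greedyRemover p) x t
    rw [play_succ]
    set s := G.play σ (G.greedyRemover p) x t
    set y : Arrangement S := (σ s.history s.field : Arrangement S) with hy
    have hys : y ≤ s.field := (σ s.history s.field).2
    have hy0 : ∀ c, y c ≠ 0 → c.1 ≠ 0 := fun c hc =>
      hf c fun h0 => hc (le_antisymm (h0 ▸ hys c) bot_le)
    have hi := Classical.epsilon_spec (G.exists_potential_shift_le hp hy0)
    set i := Classical.epsilon fun i => G.potential p (G.shift i y) ≤ G.potential p y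
    set z := (s.field - y) + G.shift i y with hz
    change ((s.won + G.gain z : ℝ≥0) : ℝ) + G.potential p (G.clear z) ≤ _
    have h1 := G.gain_add_potential_clear p z
    have h2 : G.potential p z =
        G.potential p s.field - G.potential p y + G.potential p (G.shift i y) := by
      rw [hz, potential, dot_add, dot_sub hys]
      rfl
    push_cast
    linarith

theorem upperValue_le [Fintype S] (G : GoldSandGame S F) [Nonempty F] {p : F → ℝ} (hp : p ∈ stdSimplex ℝ F)
    (x : Arrangement S) : G.upperValue x ≤ ENNReal.ofReal (G.potential p x) := by
  refine iInf_le_of_le (G.greedyRemover p) (iSup_le fun σ => iSup_le fun t => ?_)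
  rw [ENNReal.le_ofReal_iff_toReal_le ENNReal.coe_ne_top (G.potential_nonneg hp x),
    ENNReal.coe_toReal]
  have h1 := G.won_add_potential_greedyRemover_le hp σ x t
  have h2 := G.potential_nonneg hp (G.play σ (G.greedyRemover p) x t).field
  linarith

theorem potential_le_height (G : GoldSandGame S F) {p : F → ℝ} (hp : p ∈ stdSimplex ℝ F)
    {x : Arrangement S} (hx : ∀ c, x c ≠ 0 → c.1 ≠ 0) : G.potential p x ≤ height x :=
  dot_le_dot fun c hc => (G.weight_le_one hp _ _).trans
    (Nat.one_le_cast.2 (Nat.one_le_iff_ne_zero.2 (hx c hc)))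

/-- The running share `ε * n` is the coefficient of the first order term in the expansion of the
weight, so the move realizes that term cell by cell. The remainder `n ^ 2 * ε ^ 2` is at most `ε ^ 2
* N * n`, which sums to a multiple of the height. -/
theorem potential_tilt_le [DecidableEq F] (G : GoldSandGame S F)
    (hτ : ∀ i j u, G.τ i (G.τ j u) = G.τ j (G.τ i u)) {p : F → ℝ}
    (hp : p ∈ stdSimplex ℝ F) {ε : ℝ≥0} (h1 : ε ≤ 1) {x : Arrangement S} {N : ℕ}
    (hx : ∀ c, x c ≠ 0 → c.1 ≤ N) (hε : ε * N ≤ 1) (i : F) :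
    G.potential (tilt p i ε) x ≤
      G.potential p ((x - proportional ε x) + G.shift i (proportional ε x)) +
        ε ^ 2 * N * height x := by
  rw [potential, potential, dot_add, dot_sub (proportional_le ε x), dot_shift,
    dot_proportional hx hε, dot_proportional hx hε, height, ← dot_mul_right, sub_add_eq_add_sub,
    ← dot_add_right, sub_add_eq_add_sub, le_sub_iff_add_le, ← dot_add_right, ← dot_add_right]
  refine dot_le_dot fun c hc => ?_
  have h2 := G.weight_tilt_le_expansion hτ hp i ε.2 h1 c.1 c.2
  have h3 : (c.1 : ℝ) ≤ N := Nat.cast_le.2 (hx c hc)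
  have h4 : (ε : ℝ) ^ 2 * c.1 * c.1 ≤ (ε : ℝ) ^ 2 * c.1 * N :=
    mul_le_mul_of_nonneg_left h3 (by positivity)
  simp only [NNReal.val_eq_coe] at h2
  linarith

/-- Pusher's strategy that runs sand at a rate proportional to its level. -/
noncomputable def proportionalPusher (G : GoldSandGame S F) (ε : ℝ≥0) : G.PusherStrategy :=
  fun _ x => ⟨proportional ε x, proportional_le ε x⟩

/-- The term `ε * N * height` is a reserve: it shrinks by at least `ε ^ 2 * N * height s.field` in a
round, which pays for that round's error. -/
theorem proportionalPusher_invariant [Fintype S] (G : GoldSandGame S F)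
    (hτ : ∀ i j u, G.τ i (G.τ j u) = G.τ j (G.τ i u)) {ε : ℝ≥0} (h1 : ε ≤ 1)
    {x : Arrangement S} {N : ℕ} (hx : ∀ c, x c ≠ 0 → c.1 ≤ N) (hε : ε * N ≤ 1) {v : ℝ}
    (hv : ∀ p ∈ stdSimplex ℝ F, v ≤ G.potential p x) (ρ : G.RemoverStrategy) (t : ℕ) :
    let s := G.play (G.proportionalPusher ε) ρ x t
    (∀ c, s.field c ≠ 0 → c.1 ≤ N) ∧ height s.field ≤ (1 - ε) ^ t * height x ∧
      ∀ p ∈ stdSimplex ℝ F,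
        v - ε * N * height x + ε * N * height s.field ≤ s.won + G.potential p s.field := by
  classical
  have hN : (0 : ℝ) ≤ ε * N := by positivity
  induction t with
  | zero =>
    have h0 : height (G.clear x) ≤ height x := G.dot_clear_le x fun _ => Nat.cast_nonneg _
    refine ⟨fun c hc => hx c (clear_apply_ne_zero hc).2, ?_, fun p hp => ?_⟩
    · rw [pow_zero, one_mul]
      exact h0
    · have h2 := G.gain_add_potential_clear p x
      have h3 := mul_le_mul_of_nonneg_left h0 hN
      have h4 := hv p hp
      change _ + _ * height (G.clear x) ≤ (G.gain x : ℝ) + G.potential p (G.clear x)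
      linarith
  | succ t ih =>
    obtain ⟨ihN, ihh, ihp⟩ := ih
    have hf := G.play_field_level_ne_zero (G.proportionalPusher ε) ρ x t
    rw [play_succ]
    set s := G.play (G.proportionalPusher ε) ρ x t
    set i := ρ s.history s.field (proportional ε s.field)
    set z := (s.field - proportional ε s.field) + G.shift i (proportional ε s.field) with hz
    have hzh : height z = (1 - ε) * height s.field := G.height_proportional_step hf ihN hε i
    have hzc : height (G.clear z) ≤ height z := G.dot_clear_le z fun _ => Nat.cast_nonneg _
    refine ⟨fun c hc => G.step_level_le (proportional_le ε s.field) i ihN c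
      (clear_apply_ne_zero hc).2, ?_, fun p hp => ?_⟩
    · change height (G.clear z) ≤ _
      rw [pow_succ', mul_assoc]
      exact hzc.trans (hzh.le.trans
        (mul_le_mul_of_nonneg_left ihh (sub_nonneg.2 (by exact_mod_cast h1))))
    · change _ + _ * height (G.clear z) ≤ ((s.won + G.gain z : ℝ≥0) : ℝ) +
        G.potential p (G.clear z)
      have h2 := G.gain_add_potential_clear p z
      have h3 := G.potential_tilt_le hτ hp h1 ihN hε i
      -- The bound for all `p` is essential here: it is used at `p` tilted towards Remover's reply.
      have h4 := ihp _ (tilt_mem hp i ε.2 h1)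
      simp only [NNReal.val_eq_coe] at h4
      have h5 := mul_le_mul_of_nonneg_left (hzc.trans hzh.le) hN
      push_cast
      linarith

theorem le_lowerValue [Fintype S] (G : GoldSandGame S F)
    (hτ : ∀ i j u, G.τ i (G.τ j u) = G.τ j (G.τ i u)) [Nonempty F] {x : Arrangement S} {v : ℝ}
    (hv : ∀ p ∈ stdSimplex ℝ F, v ≤ G.potential p x) :
    ENNReal.ofReal v ≤ G.lowerValue x := by
  classical
  obtain ⟨N, hN1, hN⟩ := exists_level_le x
  obtain ⟨p, hp⟩ : ∃ p, p ∈ stdSimplex ℝ F :=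
    ⟨_, single_mem_stdSimplex ℝ (Classical.arbitrary F)⟩
  have key (ε : ℝ≥0) (h0 : 0 < ε) (hε : ε * N ≤ 1) :
      ENNReal.ofReal (v - ε * N * height x) ≤ G.lowerValue x := by
    have h1 : ε ≤ 1 := le_trans (le_mul_of_one_le_right bot_le (Nat.one_le_cast.2 hN1)) hε
    refine le_iSup_of_le (G.proportionalPusher ε) (le_iInf fun ρ => ?_)
    -- The sand still on the field is worth at most its height, at any one `p`.
    have h2 (t : ℕ) : ENNReal.ofReal (v - ε * N * height x - (1 - ε) ^ t * height x) ≤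
        G.totalWin (G.proportionalPusher ε) ρ x := by
      refine le_iSup_of_le t ?_
      obtain ⟨-, h3, h4⟩ := G.proportionalPusher_invariant hτ h1 hN hε hv ρ t
      have h5 := G.potential_le_height hp
        (G.play_field_level_ne_zero (G.proportionalPusher ε) ρ x t)
      have h6 : 0 ≤ (ε : ℝ) * N * height (G.play (G.proportionalPusher ε) ρ x t).field :=
        mul_nonneg (by positivity) (height_nonneg _)
      rw [← ENNReal.ofReal_coe_nnreal]
      refine ENNReal.ofReal_le_ofReal ?_
      have h7 := h4 p hp
      linarith
    have h3 : Filter.Tendsto (fun t : ℕ => (1 - (ε : ℝ)) ^ t) Filter.atTop (nhds 0) :=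
      tendsto_pow_atTop_nhds_zero_of_lt_one (sub_nonneg.2 (by exact_mod_cast h1))
        (sub_lt_self _ (by exact_mod_cast h0))
    have h4 : Filter.Tendsto (fun t : ℕ => v - ε * N * height x - (1 - (ε : ℝ)) ^ t * height x)
        Filter.atTop (nhds (v - ε * N * height x)) := by
      simpa using (h3.mul_const (height x)).const_sub (v - ε * N * height x)
    exact le_of_tendsto' (ENNReal.tendsto_ofReal h4) h2
  -- Taking `ε = 1 / ((k + 1) * N)` makes the total loss `height x / (k + 1)`.
  have h1 (k : ℕ) : ENNReal.ofReal (v - 1 / ((k : ℝ) + 1) * height x) ≤ G.lowerValue x := by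
    have hN0 : (N : ℝ) ≠ 0 := by exact_mod_cast (by omega : N ≠ 0)
    have hN0' : (N : ℝ≥0) ≠ 0 := by exact_mod_cast (by omega : N ≠ 0)
    have h2 : (1 / ((k : ℝ≥0) + 1) / N) * N = 1 / ((k : ℝ≥0) + 1) := div_mul_cancel₀ _ hN0'
    have h3 := key (1 / ((k : ℝ≥0) + 1) / N) (by positivity) (by
      rw [h2]
      exact div_le_one_of_le₀ (by simp) bot_le)
    push_cast at h3
    rwa [div_mul_cancel₀ _ hN0] at h3
  have h2 : Filter.Tendsto (fun k : ℕ => v - 1 / ((k : ℝ) + 1) * height x) Filter.atTop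
      (nhds v) := by
    simpa using
      ((tendsto_one_div_add_atTop_nhds_zero_nat (𝕜 := ℝ)).mul_const (height x)).const_sub v
  exact le_of_tendsto' (ENNReal.tendsto_ofReal h2) h1

/-- A gold sand game with commuting mappings has a value, the minimum of the potential over the
distributions on the mappings. -/
theorem exists_value [Fintype S] (G : GoldSandGame S F)
    (hτ : ∀ i j u, G.τ i (G.τ j u) = G.τ j (G.τ i u)) [Nonempty F] (x : Arrangement S) :
    ∃ v : ℝ≥0, IsLeast ((fun p => G.potential p x) '' stdSimplex ℝ F) (v : ℝ) ∧
      G.lowerValue x = v ∧ G.upperValue x = v := by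
  classical
  obtain ⟨p, hp, hmin⟩ := (isCompact_stdSimplex ℝ F).exists_isMinOn
    ⟨_, single_mem_stdSimplex ℝ (Classical.arbitrary F)⟩ (G.continuous_potential x).continuousOn
  have hlow : ENNReal.ofReal (G.potential p x) ≤ G.lowerValue x :=
    G.le_lowerValue hτ fun q hq => hmin hq
  have hup := G.upperValue_le hp x
  have hmid := G.lowerValue_le_upperValue x
  refine ⟨(G.potential p x).toNNReal, ?_, ?_, ?_⟩
  · rw [Real.coe_toNNReal _ (G.potential_nonneg hp x)]
    refine ⟨⟨p, hp, rfl⟩, ?_⟩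
    rintro _ ⟨q, hq, rfl⟩
    exact hmin hq
  · exact le_antisymm (hmid.trans hup) hlow
  · exact le_antisymm hup (hlow.trans hmid)

end Value

end GoldSandGame

/-! ### Inclusion-exclusion for the panchromatic weights -/

section Panchromatic

variable {r : ℕ}

/-- The alternating sum for the weight of the cell `(n, u)`, also at level `0`. -/
def panchromaticSum (p : Fin r → ℝ) (n : ℕ) (u : Fin r → Bool) : ℝ :=
  ∑ M ∈ (Finset.univ : Finset (Fin r → Bool)).filter
      (fun M => (∀ l, u l ≤ M l) ∧ M ≠ (fun _ => true)),
    (-1 : ℝ) ^ (r - (Finset.univ.filter (fun l => M l = true)).card - 1) *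
      (∑ l ∈ Finset.univ.filter (fun l => M l = true), p l) ^ n

/-- The sum factors over the bits, and a bit with `u l = false` contributes `1 - 1 = 0`. -/
theorem sum_prod_sign_eq_zero {u : Fin r → Bool} (hu : u ≠ fun _ => true) :
    ∑ M : Fin r → Bool, ∏ l, (if u l ≤ M l then (if M l = true then (1 : ℝ) else -1) else 0)
      = 0 := by
  obtain ⟨l, hl⟩ := Function.ne_iff.1 hu
  have hl' : u l = false := by simpa using hl
  rw [← Fintype.prod_sum 
    (fun l b => if u l ≤ b then (if b = true then (1 : ℝ) else -1) else 0)]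
  exact Finset.prod_eq_zero (Finset.mem_univ l) (by simp [hl'])

/-- The exponent is the number of zeros of `M` minus one, not truncated because `M` has a zero. -/
theorem neg_one_pow_card_eq {M : Fin r → Bool} (hM : M ≠ fun _ => true) :
    (-1 : ℝ) ^ (r - (Finset.univ.filter (fun l => M l = true)).card - 1) =
      -∏ l, (if M l = true then (1 : ℝ) else -1) := by
  have h1 := Finset.card_filter_add_card_filter_not (s := Finset.univ) (fun l => M l = true)
  rw [Finset.card_univ, Fintype.card_fin] at h1
  obtain ⟨l, hl⟩ := Function.ne_iff.1 hM
  have h2 : 0 < (Finset.univ.filter fun l => ¬ M l = true).card :=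
    Finset.card_pos.2 ⟨l, by simpa using hl⟩
  rw [Finset.prod_ite, Finset.prod_const_one, one_mul, Finset.prod_const]
  obtain ⟨k, hk⟩ := Nat.exists_eq_succ_of_ne_zero h2.ne'
  rw [hk, pow_succ, show r - (Finset.univ.filter (fun l => M l = true)).card - 1 = k by omega]
  ring

theorem panchromaticSum_zero (p : Fin r → ℝ) (u : Fin r → Bool) :
    panchromaticSum p 0 u = if u = (fun _ => true) then 0 else 1 := by
  split_ifs with hu
  · refine Finset.sum_eq_zero fun M hM => ?_
    obtain ⟨-, h1, h2⟩ := Finset.mem_filter.1 hM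
    exact absurd (funext fun l => top_le_iff.1 (by simpa [hu] using h1 l)) h2
  · have h1 := sum_prod_sign_eq_zero hu
    -- The all-ones term is `1`; the other terms sum to the negative of the level `0` sum, all
    -- powers there being `1`.
    rw [← Finset.add_sum_erase _ _ (Finset.mem_univ fun _ => true)] at h1
    have h2 : ∏ l, (if u l ≤ true then (if true = true then (1 : ℝ) else -1) else 0) = 1 :=
      Finset.prod_eq_one fun l _ => by simp [Bool.le_true]
    rw [h2] at h1
    have h3 : panchromaticSum p 0 u = -∑ M ∈ Finset.univ.erase (fun _ => true),
        ∏ l, (if u l ≤ M l then (if M l = true then (1 : ℝ) else -1) else 0) := by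
      rw [panchromaticSum, ← Finset.sum_neg_distrib, Finset.sum_filter,
        ← Finset.filter_ne' Finset.univ, Finset.sum_filter]
      refine Finset.sum_congr rfl fun M _ => ?_
      by_cases hM : M = fun _ => true
      · simp [hM]
      · by_cases hle : ∀ l, u l ≤ M l
        · rw [if_pos ⟨hle, hM⟩, if_pos hM, neg_one_pow_card_eq hM, pow_zero, mul_one]
          simp only [hle, if_true]
        · rw [if_neg (fun h => hle h.1), if_pos hM]
          obtain ⟨l, hl⟩ := not_forall.1 hle
          rw [Finset.prod_eq_zero (Finset.mem_univ l) (if_neg hl), neg_zero]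
    linarith

/-- Since `τ j u ≤ M` means `u ≤ M` and `M j = true`, exchanging the sums turns the sum over `j`
into one more factor `S(M)`. -/
theorem panchromaticSum_succ (p : Fin r → ℝ) (n : ℕ) (u : Fin r → Bool) :
    panchromaticSum p (n + 1) u =
      ∑ j, p j * panchromaticSum p n ((panchromaticGame r).τ j u) := by
  simp only [panchromaticSum, Finset.mul_sum, Finset.sum_filter]
  rw [Finset.sum_comm]
  refine Finset.sum_congr rfl fun M _ => ?_
  have hτ (j : Fin r) : (∀ l, (panchromaticGame r).τ j u l ≤ M l) ↔
      (∀ l, u l ≤ M l) ∧ M j = true := by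
    have h (l : Fin r) : (panchromaticGame r).τ j u l ≤ M l ↔
        u l ≤ M l ∧ (l = j → M l = true) := by
      change (u l || decide (l = j)) ≤ M l ↔ _
      by_cases hl : l = j <;> cases u l <;> cases M l <;> simp [hl]
    simp only [h, forall_and, forall_eq]
  simp only [hτ]
  by_cases hM : (∀ l, u l ≤ M l) ∧ M ≠ fun _ => true
  · rw [if_pos hM, pow_succ, ← mul_assoc, Finset.mul_sum]
    refine Finset.sum_congr rfl fun j _ => ?_
    by_cases hj : M j = true
    · rw [if_pos hj, if_pos ⟨⟨hM.1, hj⟩, hM.2⟩, mul_comm]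
    · rw [if_neg hj, if_neg (fun h => hj h.1.2), mul_zero, mul_zero]
  · rw [if_neg hM]
    refine (Finset.sum_eq_zero fun j _ => ?_).symm
    rw [if_neg (fun h => hM ⟨h.1.1, h.2⟩), mul_zero]

theorem panchromaticSum_eq_weight (p : Fin r → ℝ) (n : ℕ) (u : Fin r → Bool) :
    panchromaticSum p n u = (panchromaticGame r).weight p n u := by
  induction n generalizing u with
  | zero => exact panchromaticSum_zero p u
  | succ n ih => simp only [panchromaticSum_succ, ih]; rfl

theorem panchromaticWeight_eq_weight (p : Fin r → ℝ) (n : ℕ) (u : Fin r → Bool) :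
    panchromaticWeight p n u = (panchromaticGame r).weight p n u := by
  rw [panchromaticWeight]
  split_ifs with hn hu
  · rw [hn, hu]; exact ((panchromaticGame r).weight_dead p 0).symm
  · rw [hn]; exact (if_neg hu).symm
  · exact panchromaticSum_eq_weight p n u

end Panchromatic

theorem proposition3 (r : ℕ) (hr : 1 ≤ r) (x : Arrangement (Fin r → Bool)) :
    ∃ v : ℝ≥0,
      IsLeast ((fun p : Fin r → ℝ => panchromaticDot x p) '' stdSimplex ℝ (Fin r)) (v : ℝ) ∧
      (panchromaticGame r).lowerValue x = (v : ℝ≥0∞) ∧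
      (panchromaticGame r).upperValue x = (v : ℝ≥0∞) := by
  have : Nonempty (Fin r) := ⟨⟨0, hr⟩⟩
  have h1 (p : Fin r → ℝ) : panchromaticDot x p = (panchromaticGame r).potential p x := by
    simp only [panchromaticDot, panchromaticWeight_eq_weight]
    rfl
  simp only [h1]
  refine (panchromaticGame r).exists_value (fun i j u => ?_) x
  funext l
  change ((u l || _) || _) = ((u l || _) || _)
  rw [Bool.or_assoc, Bool.or_assoc, Bool.or_comm (decide (l = j))]
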